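/- Let $H,K$ be complex Hilbert spaces. The $w^*$-topology on $B(H,K)$ is its topology as the dual of the trace class operators, and $[\,\cdot\,]^{-w^*}$ denotes the $w^*$-closed linear span. Let $A\subseteq B(H)$ and $B\subseteq B(K)$ be $w^*$-closed subalgebras with $I_H\in A$, $I_K\in B$, and suppose that they are TRO-equivalent, in the sense that there is a ternary ring of operators $\mathcal M\subseteq B(H,K)$ (a linear subspace with $\mathcal M\mathcal M^*\mathcal M\subseteq\mathcal M$) such that $$A=[\mathcal M^*B\mathcal M]^{-w^*}\quad\text{and}\quad B=[\mathcal MA\mathcal M^*]^{-w^*}.$$ Then there exist an infinite cardinal $J$ and a unitary operator $U\in B(H\otimes\ell^2_J,\,K\otimes\ell^2_J)$ such that $$B\,\bar\otimes\,M_J=U\,(A\,\bar\otimes\,M_J)\,U^*.$$ Here $\otimes$ is the Hilbert space tensor product, $M_J=B(\ell^2_J)$ is the space of $J\times J$ complex matrices whose finite submatrices have uniformly bounded norms, and $X\bar\otimes M_J$ is the $w^*$-closed linear span of the operators $x\otimes y$ with $x\in X$, $y\in M_J$. -/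

import Mathlib

open scoped TensorProduct InnerProductSpace

universe u v

noncomputable section

/-- The Hilbert space tensor product `H ⊗ K`: the completion of the algebraic tensor product for the
inner product with `⟪a ⊗ b, c ⊗ d⟫ = ⟪a, c⟫ * ⟪b, d⟫`. -/
abbrev HilbertTensor (H K : Type*)
    [NormedAddCommGroup H] [InnerProductSpace ℂ H]
    [NormedAddCommGroup K] [InnerProductSpace ℂ K] : Type _ :=
  UniformSpace.Completion (H ⊗[ℂ] K)

/-- The Hilbert space `ℓ²_J` of square-summable families of complex numbers indexed by `J`. -/
abbrev EllTwo (J : Type*) : Type _ := lp (fun _ : J => ℂ) 2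

/-- The operator `x ⊗ y` from `H₁ ⊗ K₁` to `H₂ ⊗ K₂`, for bounded operators `x` and `y`. -/
def opTensor {H₁ H₂ K₁ K₂ : Type*}
    [NormedAddCommGroup H₁] [InnerProductSpace ℂ H₁]
    [NormedAddCommGroup H₂] [InnerProductSpace ℂ H₂]
    [NormedAddCommGroup K₁] [InnerProductSpace ℂ K₁]
    [NormedAddCommGroup K₂] [InnerProductSpace ℂ K₂]
    (x : H₁ →L[ℂ] H₂) (y : K₁ →L[ℂ] K₂) :
    HilbertTensor H₁ K₁ →L[ℂ] HilbertTensor H₂ K₂ :=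
  (TensorProduct.mapL x y).completion

/-- The `w*`-topology of `B(H, K)` as the dual of the trace class operators from `K` to `H`
(the ultraweak topology): the coarsest topology for which the functionals
`T ↦ ∑ₙ ⟪ηₙ, T ξₙ⟫` are continuous, where `ξ` and `η` are square-summable sequences of vectors. -/
abbrev weakStarTopology (H K : Type*)
    [NormedAddCommGroup H] [InnerProductSpace ℂ H]
    [NormedAddCommGroup K] [InnerProductSpace ℂ K] : TopologicalSpace (H →L[ℂ] K) :=
  ⨅ (ξ : lp (fun _ : ℕ => H) 2) (η : lp (fun _ : ℕ => K) 2),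
    TopologicalSpace.induced (fun T : H →L[ℂ] K => ∑' n, ⟪η n, T (ξ n)⟫_ℂ) inferInstance

/-- A set of operators that is closed in the `w*`-topology. -/
def IsWeakStarClosed {H K : Type*}
    [NormedAddCommGroup H] [InnerProductSpace ℂ H]
    [NormedAddCommGroup K] [InnerProductSpace ℂ K] (S : Set (H →L[ℂ] K)) : Prop :=
  @IsClosed _ (weakStarTopology H K) S

/-- The `w*`-closed linear span `[S]^{-w*}` of a set of operators. -/
def weakStarSpan {H K : Type*}
    [NormedAddCommGroup H] [InnerProductSpace ℂ H]
    [NormedAddCommGroup K] [InnerProductSpace ℂ K] (S : Set (H →L[ℂ] K)) : Set (H →L[ℂ] K) :=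
  @closure _ (weakStarTopology H K) (Submodule.span ℂ S : Set (H →L[ℂ] K))

/-- A ternary ring of operators: a subspace `M` of `B(H, K)` with `M M* M ⊆ M`. -/
def IsTRO {H K : Type*}
    [NormedAddCommGroup H] [InnerProductSpace ℂ H] [CompleteSpace H]
    [NormedAddCommGroup K] [InnerProductSpace ℂ K] [CompleteSpace K]
    (M : Submodule ℂ (H →L[ℂ] K)) : Prop :=
  ∀ a ∈ M, ∀ b ∈ M, ∀ c ∈ M, a ∘L b.adjoint ∘L c ∈ M

/-- `A ⊆ B(H)` and `B ⊆ B(K)` are TRO-equivalent via one TRO `M ⊆ B(H, K)`: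
`A = [M* B M]^{-w*}` and `B = [M A M*]^{-w*}`. -/
def TROEquivalent {H K : Type*}
    [NormedAddCommGroup H] [InnerProductSpace ℂ H] [CompleteSpace H]
    [NormedAddCommGroup K] [InnerProductSpace ℂ K] [CompleteSpace K]
    (A : Set (H →L[ℂ] H)) (B : Set (K →L[ℂ] K)) : Prop :=
  ∃ M : Submodule ℂ (H →L[ℂ] K), IsTRO M ∧
    A = weakStarSpan {T | ∃ m ∈ M, ∃ b ∈ B, ∃ n ∈ M, T = m.adjoint ∘L b ∘L n} ∧
    B = weakStarSpan {T | ∃ m ∈ M, ∃ a ∈ A, ∃ n ∈ M, T = m ∘L a ∘L n.adjoint}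

/-- The normal spatial tensor product of `X ⊆ B(H₁, H₂)` and `Y ⊆ B(K₁, K₂)`: the `w*`-closed linear
span in `B(H₁ ⊗ K₁, H₂ ⊗ K₂)` of the operators `x ⊗ y` with `x ∈ X` and `y ∈ Y`. -/
def normalTensor {H₁ H₂ K₁ K₂ : Type*}
    [NormedAddCommGroup H₁] [InnerProductSpace ℂ H₁]
    [NormedAddCommGroup H₂] [InnerProductSpace ℂ H₂]
    [NormedAddCommGroup K₁] [InnerProductSpace ℂ K₁]
    [NormedAddCommGroup K₂] [InnerProductSpace ℂ K₂]
    (X : Set (H₁ →L[ℂ] H₂)) (Y : Set (K₁ →L[ℂ] K₂)) :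
    Set (HilbertTensor H₁ K₁ →L[ℂ] HilbertTensor H₂ K₂) :=
  weakStarSpan {T | ∃ x ∈ X, ∃ y ∈ Y, T = opTensor x y}

/-- `M_J`, the `J × J` matrices whose finite submatrices have uniformly bounded norms, as the
operators that they define on `ℓ²_J`: these are all the bounded operators on `ℓ²_J`. -/
def matrixOps (J : Type*) : Set (EllTwo J →L[ℂ] EllTwo J) := Set.univ

end

/-! ### The w*-topology and w*-closed spans. -/

section WeakStar

open Filter Topology

/-! After tensoring with `M_J`, the TRO itself contains a unitary. Put X = M ⊗̄ M_J, a w*-closed TRO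
in B(H ⊗ ℓ²_J, K ⊗ ℓ²_J). If U ∈ X is unitary, then M A M* ⊆ B gives U (A ⊗̄ M_J) U* ⊆ B ⊗̄ M_J,
while M* B M ⊆ A gives U* (B ⊗̄ M_J) U ⊆ A ⊗̄ M_J, and the two together are the claimed equality.

The unitary comes from three facts. Since B = [M A M*] contains the identity, M* annihilates no
nonzero vector of K (`eq_zero_of_adjoint_apply_eq_zero`). A Zorn argument then gives operators m_j
with ∑ m_j m_j* = 1 (`exists_column_isometry`). For infinite J the space ℓ²_J carries isometries
t_j, one for each j in J, with mutually orthogonal ranges, so W = ∑ m_j* ⊗ t_j is an isometry with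
W* ∈ X (`exists_isometry_of_column`). The same argument for M* gives an isometry V ∈ X in the other
direction.

Finally a Schröder–Bernstein argument carried out inside X (`exists_unitary_of_isometries`) turns V
and W into a unitary in X. -/

theorem summable_norm_mul_norm_lp {E F : Type*} [NormedAddCommGroup E]
    [NormedAddCommGroup F] (ξ : lp (fun _ : ℕ => E) 2) (η : lp (fun _ : ℕ => F) 2) :
    Summable fun n => ‖η n‖ * ‖ξ n‖ := by
  have h1 := (lp.memℓp ξ).summable (by norm_num)
  have h2 := (lp.memℓp η).summable (by norm_num)
  refine Summable.of_nonneg_of_le (fun n => by positivity) (fun n => ?_) (h1.add h2)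
  simp only [ENNReal.toReal_ofNat, Real.rpow_ofNat]
  nlinarith [sq_nonneg (‖η n‖ - ‖ξ n‖), sq_nonneg ‖η n‖, sq_nonneg ‖ξ n‖]

variable {H K L : Type*}
  [NormedAddCommGroup H] [InnerProductSpace ℂ H]
  [NormedAddCommGroup K] [InnerProductSpace ℂ K]
  [NormedAddCommGroup L] [InnerProductSpace ℂ L]

theorem summable_inner_apply_lp (ξ : lp (fun _ : ℕ => H) 2) (η : lp (fun _ : ℕ => K) 2)
    (T : H →L[ℂ] K) : Summable fun n => ⟪η n, T (ξ n)⟫_ℂ := by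
  refine Summable.of_norm_bounded ((summable_norm_mul_norm_lp ξ η).mul_left ‖T‖) fun n => ?_
  calc ‖⟪η n, T (ξ n)⟫_ℂ‖ ≤ ‖η n‖ * ‖T (ξ n)‖ := norm_inner_le_norm _ _
    _ ≤ ‖η n‖ * (‖T‖ * ‖ξ n‖) := by gcongr; exact T.le_opNorm _
    _ = ‖T‖ * (‖η n‖ * ‖ξ n‖) := by ring

/-- The functional `T ↦ ∑ₙ ⟪ηₙ, T ξₙ⟫`. -/
noncomputable def weakStarFunctional (ξ : lp (fun _ : ℕ => H) 2) (η : lp (fun _ : ℕ => K) 2) :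
    (H →L[ℂ] K) →ₗ[ℂ] ℂ where
  toFun T := ∑' n, ⟪η n, T (ξ n)⟫_ℂ
  map_add' S T := by
    simp only [add_apply, inner_add_right]
    exact (summable_inner_apply_lp ξ η S).tsum_add (summable_inner_apply_lp ξ η T)
  map_smul' c T := by
    simp only [smul_apply, inner_smul_right, RingHom.id_apply, smul_eq_mul]
    exact tsum_mul_left

theorem weakStarTopology_isTopologicalAddGroup :
    @IsTopologicalAddGroup (H →L[ℂ] K) (weakStarTopology H K) _ :=
  topologicalAddGroup_iInf fun ξ => topologicalAddGroup_iInf fun η =>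
    topologicalAddGroup_induced (weakStarFunctional ξ η)

theorem weakStarTopology_continuousSMul :
    @ContinuousSMul ℂ (H →L[ℂ] K) _ _ (weakStarTopology H K) :=
  continuousSMul_iInf fun ξ => continuousSMul_iInf fun η =>
    continuousSMul_induced (weakStarFunctional ξ η)

theorem continuous_weakStarTopology_rng {α : Type*} [TopologicalSpace α] {f : α → H →L[ℂ] K}
    (h : ∀ (ξ : lp (fun _ : ℕ => H) 2) (η : lp (fun _ : ℕ => K) 2),
      Continuous fun a => ∑' n, ⟪η n, f a (ξ n)⟫_ℂ) :
    @Continuous _ _ _ (weakStarTopology H K) f :=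
  continuous_iInf_rng.2 fun ξ => continuous_iInf_rng.2 fun η => continuous_induced_rng.2 (h ξ η)

theorem continuous_weakStarFunctional
    (ξ : lp (fun _ : ℕ => H) 2) (η : lp (fun _ : ℕ => K) 2) :
    @Continuous _ _ (weakStarTopology H K) _ fun T : H →L[ℂ] K => ∑' n, ⟪η n, T (ξ n)⟫_ℂ :=
  continuous_iInf_dom (continuous_iInf_dom continuous_induced_dom)

theorem continuous_inner_apply_weakStarTopology (x : H) (y : K) :
    @Continuous _ _ (weakStarTopology H K) _ fun T : H →L[ℂ] K => ⟪y, T x⟫_ℂ := by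
  convert continuous_weakStarFunctional (lp.single 2 0 x) (lp.single 2 0 y) using 2 with T
  rw [tsum_eq_single 0]
  · simp
  · intro n hn
    simp [Pi.single_eq_of_ne hn]

/-- The image of a square-summable sequence under a bounded operator. -/
noncomputable def lpMap (a : H →L[ℂ] K) (ξ : lp (fun _ : ℕ => H) 2) : lp (fun _ : ℕ => K) 2 :=
  ⟨fun n => a (ξ n), by
    refine memℓp_gen ?_
    refine Summable.of_nonneg_of_le (fun n => by positivity) (fun n => ?_)
      (((lp.memℓp ξ).summable (by norm_num)).mul_left (‖a‖ ^ 2))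
    simp only [ENNReal.toReal_ofNat, Real.rpow_ofNat]
    rw [← mul_pow]
    gcongr
    exact a.le_opNorm _⟩

theorem continuous_comp_left_weakStarTopology (a : K →L[ℂ] L) [CompleteSpace K] [CompleteSpace L] :
    @Continuous _ _ (weakStarTopology H K) (weakStarTopology H L)
      fun T : H →L[ℂ] K => a ∘L T := by
  let _ := weakStarTopology H K
  refine continuous_weakStarTopology_rng fun ξ η => ?_
  convert continuous_weakStarFunctional ξ (lpMap a.adjoint η) using 4 with T n
  simp [lpMap, ContinuousLinearMap.adjoint_inner_left]

theorem continuous_comp_right_weakStarTopology (a : L →L[ℂ] H) :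
    @Continuous _ _ (weakStarTopology H K) (weakStarTopology L K)
      fun T : H →L[ℂ] K => T ∘L a := by
  let _ := weakStarTopology H K
  exact continuous_weakStarTopology_rng fun ξ η =>
    continuous_weakStarFunctional (lpMap a ξ) η

theorem continuous_adjoint_weakStarTopology [CompleteSpace H] [CompleteSpace K] :
    @Continuous _ _ (weakStarTopology H K) (weakStarTopology K H)
      fun T : H →L[ℂ] K => T.adjoint := by
  let _ := weakStarTopology H K
  refine continuous_weakStarTopology_rng fun ξ η => ?_
  convert Complex.continuous_conj.comp (continuous_weakStarFunctional η ξ) using 2 with T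
  rw [Function.comp_apply, Complex.conj_tsum]
  simp [ContinuousLinearMap.adjoint_inner_right]

/-- The `w*`-closed linear span as a subspace. -/
noncomputable def weakStarSubmodule (S : Set (H →L[ℂ] K)) : Submodule ℂ (H →L[ℂ] K) :=
  letI := weakStarTopology H K
  haveI : IsTopologicalAddGroup (H →L[ℂ] K) := weakStarTopology_isTopologicalAddGroup
  haveI : ContinuousSMul ℂ (H →L[ℂ] K) := weakStarTopology_continuousSMul
  (Submodule.span ℂ S).topologicalClosure

theorem isWeakStarClosed_weakStarSubmodule (S : Set (H →L[ℂ] K)) :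
    IsWeakStarClosed (weakStarSubmodule S : Set (H →L[ℂ] K)) :=
  @isClosed_closure _ (weakStarTopology H K) _

theorem subset_weakStarSubmodule (S : Set (H →L[ℂ] K)) {T : H →L[ℂ] K} (hT : T ∈ S) :
    T ∈ weakStarSubmodule S :=
  @subset_closure _ (weakStarTopology H K) _ _ (Submodule.subset_span hT)

theorem weakStarSubmodule_le {S : Set (H →L[ℂ] K)} {N : Submodule ℂ (H →L[ℂ] K)}
    (hS : S ⊆ N) (hN : IsWeakStarClosed (N : Set (H →L[ℂ] K))) : weakStarSubmodule S ≤ N :=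
  @closure_minimal _ (weakStarTopology H K) _ _ (Submodule.span_le.2 hS) hN

/-- Multiplication is only separately w*-continuous, so the closure is taken in one factor at a
time. -/
theorem comp_mem_weakStarSubmodule [CompleteSpace H] [CompleteSpace K] [CompleteSpace L]
    {S : Set (K →L[ℂ] L)} {R : Set (H →L[ℂ] K)} {Q : Set (H →L[ℂ] L)}
    (h : ∀ s ∈ S, ∀ r ∈ R, s ∘L r ∈ weakStarSubmodule Q)
    {s : K →L[ℂ] L} (hs : s ∈ weakStarSubmodule S)
    {r : H →L[ℂ] K} (hr : r ∈ weakStarSubmodule R) : s ∘L r ∈ weakStarSubmodule Q := by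
  have h1 : ∀ s ∈ S, ∀ r ∈ weakStarSubmodule R, s ∘L r ∈ weakStarSubmodule Q := by
    intro s hs r hr
    have : weakStarSubmodule R ≤ (weakStarSubmodule Q).comap
        ((ContinuousLinearMap.compL ℂ H K L s).toLinearMap) :=
      weakStarSubmodule_le (fun r hr => h s hs r hr)
        (@IsClosed.preimage _ _ (weakStarTopology H K) (weakStarTopology H L) _
          (continuous_comp_left_weakStarTopology s) _ (isWeakStarClosed_weakStarSubmodule Q))
    exact this hr
  have : weakStarSubmodule S ≤ (weakStarSubmodule Q).comap
      (((ContinuousLinearMap.compL ℂ H K L).flip r).toLinearMap) :=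
    weakStarSubmodule_le (fun s hs => h1 s hs r hr)
      (@IsClosed.preimage _ _ (weakStarTopology K L) (weakStarTopology H L) _
        (continuous_comp_right_weakStarTopology r) _ (isWeakStarClosed_weakStarSubmodule Q))
  exact this hs

theorem adjoint_mem_weakStarSubmodule [CompleteSpace H] [CompleteSpace K]
    {S : Set (H →L[ℂ] K)} {Q : Set (K →L[ℂ] H)} (h : ∀ s ∈ S, s.adjoint ∈ weakStarSubmodule Q)
    {s : H →L[ℂ] K} (hs : s ∈ weakStarSubmodule S) : s.adjoint ∈ weakStarSubmodule Q := by
  have : weakStarSubmodule S ≤ (weakStarSubmodule Q).comap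
      (ContinuousLinearMap.adjoint (𝕜 := ℂ) (E := H) (F := K)).toLinearEquiv.toLinearMap :=
    weakStarSubmodule_le h
      (@IsClosed.preimage _ _ (weakStarTopology H K) (weakStarTopology K H) _
        continuous_adjoint_weakStarTopology _ (isWeakStarClosed_weakStarSubmodule Q))
  exact this hs

/-- On bounded sets weak operator convergence implies w*-convergence, by dominated convergence in
each defining functional. All limits of operators taken inside w*-closed spaces go through this
lemma. -/
theorem IsWeakStarClosed.mem_of_tendsto {N : Set (H →L[ℂ] K)} (hN : IsWeakStarClosed N)
    {ι : Type*} {l : Filter ι} [l.NeBot] {T : ι → H →L[ℂ] K} {T₀ : H →L[ℂ] K} {C : ℝ}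
    (hT : ∀ i, T i ∈ N) (hC : ∀ i, ‖T i‖ ≤ C)
    (h : ∀ x y, Tendsto (fun i => ⟪y, T i x⟫_ℂ) l (𝓝 ⟪y, T₀ x⟫_ℂ)) : T₀ ∈ N := by
  let _ := weakStarTopology H K
  refine IsClosed.mem_of_tendsto (f := T) (b := l) hN ?_ (Eventually.of_forall hT)
  rw [nhds_iInf]
  refine tendsto_iInf.2 fun ξ => ?_
  rw [nhds_iInf]
  refine tendsto_iInf.2 fun η => ?_
  rw [nhds_induced, tendsto_comap_iff]
  refine tendsto_tsum_of_dominated_convergence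
    ((summable_norm_mul_norm_lp ξ η).mul_left C) (fun n => h _ _) (Eventually.of_forall ?_)
  intro i n
  calc ‖⟪η n, T i (ξ n)⟫_ℂ‖ ≤ ‖η n‖ * ‖T i (ξ n)‖ := norm_inner_le_norm _ _
    _ ≤ ‖η n‖ * (C * ‖ξ n‖) := by gcongr; exact (T i).le_of_opNorm_le (hC i) _
    _ = C * (‖η n‖ * ‖ξ n‖) := by ring

end WeakStar

/-! ### Columns of operators with ∑ yⱼ* yⱼ ≤ 1. -/

section Column

open Filter Topology

variable {J E F : Type*}
  [NormedAddCommGroup E] [InnerProductSpace ℂ E]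
  [NormedAddCommGroup F] [InnerProductSpace ℂ F]

/-- The column operator `x ↦ (yⱼ x)ⱼ` of a family of operators with `∑ yⱼ* yⱼ ≤ 1`. -/
noncomputable def columnOperator (y : J → E →L[ℂ] F)
    (hy : ∀ (s : Finset J) (x : E), ∑ j ∈ s, ‖y j x‖ ^ 2 ≤ ‖x‖ ^ 2) :
    E →L[ℂ] lp (fun _ : J => F) 2 :=
  LinearMap.mkContinuous
    { toFun := fun x => ⟨fun j => y j x, memℓp_gen (by
        simpa using summable_of_sum_le (fun j => by positivity) (fun s => hy s x))⟩
      map_add' := fun _ _ => Subtype.ext (funext fun j => map_add (y j) _ _)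
      map_smul' := fun _ _ => Subtype.ext (funext fun j => map_smul (y j) _ _) } 1 (fun x => by
        rw [one_mul]
        refine lp.norm_le_of_forall_sum_le (by norm_num) (norm_nonneg x) fun s => ?_
        simpa using hy s x)

theorem columnOperator_apply (y : J → E →L[ℂ] F)
    (hy : ∀ (s : Finset J) (x : E), ∑ j ∈ s, ‖y j x‖ ^ 2 ≤ ‖x‖ ^ 2) (x : E) (j : J) :
    columnOperator y hy x j = y j x := rfl

theorem norm_columnOperator_le (y : J → E →L[ℂ] F)
    (hy : ∀ (s : Finset J) (x : E), ∑ j ∈ s, ‖y j x‖ ^ 2 ≤ ‖x‖ ^ 2) :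
    ‖columnOperator y hy‖ ≤ 1 :=
  LinearMap.mkContinuous_norm_le _ zero_le_one _

theorem hasSum_norm_sq_columnOperator (y : J → E →L[ℂ] F)
    (hy : ∀ (s : Finset J) (x : E), ∑ j ∈ s, ‖y j x‖ ^ 2 ≤ ‖x‖ ^ 2) (x : E) :
    HasSum (fun j => ‖y j x‖ ^ 2) (‖columnOperator y hy x‖ ^ 2) := by
  simpa [columnOperator_apply] using lp.hasSum_norm (by norm_num) (columnOperator y hy x)

theorem hasSum_adjoint_columnOperator [CompleteSpace E] [CompleteSpace F] (y : J → E →L[ℂ] F)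
    (hy : ∀ (s : Finset J) (x : E), ∑ j ∈ s, ‖y j x‖ ^ 2 ≤ ‖x‖ ^ 2) (x : E) :
    HasSum (fun j => (y j).adjoint (y j x))
      ((columnOperator y hy).adjoint (columnOperator y hy x)) := by
  classical
  have h := (lp.hasSum_single (by norm_num) (columnOperator y hy x)).mapL
    (columnOperator y hy).adjoint
  convert h using 2 with j
  refine ext_inner_right ℂ fun z => ?_
  rw [ContinuousLinearMap.adjoint_inner_left, ContinuousLinearMap.adjoint_inner_left,
    lp.inner_single_left]
  rfl

/-- With z the image of x, ‖z‖² = ∑ Re ⟪yⱼ x, yⱼ z⟫ ≤ (‖x‖² + ‖z‖²) / 2, which forces ‖z‖ ≤ ‖x‖. -/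
theorem norm_sum_adjoint_comp_self_le [CompleteSpace E] [CompleteSpace F] (y : J → E →L[ℂ] F)
    (hy : ∀ (s : Finset J) (x : E), ∑ j ∈ s, ‖y j x‖ ^ 2 ≤ ‖x‖ ^ 2) (s : Finset J) :
    ‖∑ j ∈ s, (y j).adjoint ∘L y j‖ ≤ 1 := by
  refine ContinuousLinearMap.opNorm_le_bound _ zero_le_one fun x => ?_
  rw [one_mul]
  by_contra! hlt
  set z := (∑ j ∈ s, (y j).adjoint ∘L y j) x with hz
  have h1 : ‖z‖ ^ 2 = (∑ j ∈ s, ⟪y j x, y j z⟫_ℂ).re := by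
    rw [← inner_self_eq_norm_sq (𝕜 := ℂ)]
    have h0 : z = ∑ j ∈ s, (y j).adjoint (y j x) := by simp [hz]
    rw [show ⟪z, z⟫_ℂ = ⟪∑ j ∈ s, (y j).adjoint (y j x), z⟫_ℂ by rw [← h0], sum_inner]
    simp only [ContinuousLinearMap.adjoint_inner_left]
    rfl
  have h2 : ‖z‖ ^ 2 ≤ (∑ j ∈ s, ‖y j x‖ ^ 2 + ∑ j ∈ s, ‖y j z‖ ^ 2) / 2 := by
    rw [h1, Complex.re_sum, ← Finset.sum_add_distrib, Finset.sum_div]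
    refine Finset.sum_le_sum fun j _ => ?_
    have := (Complex.re_le_norm _).trans (norm_inner_le_norm (𝕜 := ℂ) (y j x) (y j z))
    nlinarith [sq_nonneg (‖y j x‖ - ‖y j z‖)]
  have h3 := hy s x
  have h4 := hy s z
  nlinarith [norm_nonneg x]

end Column

/-! ### Zorn's lemma: a column of TRO elements with ∑ mⱼ mⱼ* = 1. -/

section Exhaustion

open Filter Topology

variable {H K : Type*}
  [NormedAddCommGroup H] [InnerProductSpace ℂ H] [CompleteSpace H]
  [NormedAddCommGroup K] [InnerProductSpace ℂ K] [CompleteSpace K]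

/-- Take a maximal family with ∑ mⱼ mⱼ* ≤ 1. If the defect r = 1 - ∑ mⱼ mⱼ* were nonzero,
nondegeneracy would give n ∈ N with n* r ≠ 0, and r n / ‖n‖ could be added to the family. The factor
ℕ in the index type lets an operator occur repeatedly. Closure under bounded strong limits is all
that is asked of N, so that the lemma applies to a space defined through its amplifications. -/
theorem exists_column_isometry {N : Submodule ℂ (H →L[ℂ] K)} (hN : IsTRO N)
    (hclosed : ∀ (T : Finset ((H →L[ℂ] K) × ℕ) → H →L[ℂ] K) (T₀ : H →L[ℂ] K) (C : ℝ),
      (∀ s, T s ∈ N) → (∀ s, ‖T s‖ ≤ C) →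
      (∀ x, Tendsto (fun s => T s x) atTop (𝓝 (T₀ x))) → T₀ ∈ N)
    (hnd : ∀ k : K, (∀ m ∈ N, m.adjoint k = 0) → k = 0) :
    ∃ m : (H →L[ℂ] K) × ℕ → H →L[ℂ] K, (∀ j, m j ∈ N) ∧
      ∀ k, HasSum (fun j => ‖(m j).adjoint k‖ ^ 2) (‖k‖ ^ 2) := by
  classical
  let J := (H →L[ℂ] K) × ℕ
  let P : Set (Set J) := {S | (∀ j ∈ S, j.1 ∈ N) ∧ ∀ s : Finset J, (s : Set J) ⊆ S →
    ∀ k, ∑ j ∈ s, ‖j.1.adjoint k‖ ^ 2 ≤ ‖k‖ ^ 2}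
  obtain ⟨S, hS⟩ : ∃ S, Maximal (· ∈ P) S := by
    refine zorn_subset P fun c hcP hc => ?_
    rcases c.eq_empty_or_nonempty with rfl | hne
    · refine ⟨∅, ⟨by simp, fun s hs k => ?_⟩, by simp⟩
      obtain rfl : s = ∅ := by simpa using hs
      simp
    refine ⟨⋃₀ c, ⟨?_, fun s hs k => ?_⟩, fun t ht => Set.subset_sUnion_of_mem ht⟩
    · rintro j ⟨t, ht, hj⟩
      exact (hcP ht).1 j hj
    · obtain ⟨t, ht, hst⟩ := hc.directedOn.exists_mem_subset_of_finset_subset_biUnion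
        (f := id) hne (by simpa [Set.sUnion_eq_biUnion] using hs)
      exact (hcP ht).2 s hst k
  let m : J → H →L[ℂ] K := fun j => if j ∈ S then j.1 else 0
  have hmN : ∀ j, m j ∈ N := fun j => by
    by_cases hj : j ∈ S
    · simpa [m, hj] using hS.prop.1 j hj
    · simp [m, hj]
  have hy : ∀ (s : Finset J) (k : K), ∑ j ∈ s, ‖(m j).adjoint k‖ ^ 2 ≤ ‖k‖ ^ 2 := by
    intro s k
    refine le_trans (le_of_eq ?_) (hS.prop.2 (s.filter (· ∈ S))
      (fun j hj => (Finset.mem_filter.1 hj).2) k)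
    rw [Finset.sum_filter]
    refine Finset.sum_congr rfl fun j _ => ?_
    by_cases hj : j ∈ S <;> simp [m, hj]
  let V := columnOperator (fun j => (m j).adjoint) hy
  have hV1 : ‖V‖ ≤ 1 := norm_columnOperator_le _ hy
  refine ⟨m, hmN, fun k => ?_⟩
  have hsum := hasSum_norm_sq_columnOperator _ hy k
  suffices hr : ∀ k, V.adjoint (V k) = k by
    have : ‖columnOperator (fun j => (m j).adjoint) hy k‖ ^ 2 = ‖k‖ ^ 2 := by
      have h1 : ⟪V.adjoint (V k), k⟫_ℂ = ⟪V k, V k⟫_ℂ := V.adjoint_inner_left _ _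
      rw [hr, inner_self_eq_norm_sq_to_K, inner_self_eq_norm_sq_to_K] at h1
      exact_mod_cast h1.symm
    rwa [this] at hsum
  let r : K →L[ℂ] K := 1 - V.adjoint ∘L V
  have hr_adj : r.adjoint = r := by
    simp only [r, map_sub, ContinuousLinearMap.adjoint_comp, ContinuousLinearMap.adjoint_adjoint]
    congr 1
    exact ContinuousLinearMap.adjoint_id
  -- This is r² ≤ r, true because 0 ≤ r ≤ 1.
  have hr_norm : ∀ k, ‖r k‖ ^ 2 ≤ ‖k‖ ^ 2 - ‖V k‖ ^ 2 := by
    intro k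
    have h1 : (⟪k, V.adjoint (V k)⟫_ℂ).re = ‖V k‖ ^ 2 := by
      rw [V.adjoint_inner_right]
      exact inner_self_eq_norm_sq (𝕜 := ℂ) (V k)
    have h2 := norm_sub_sq (𝕜 := ℂ) k (V.adjoint (V k))
    have h3 : ‖V.adjoint (V k)‖ ≤ ‖V k‖ := by
      refine (V.adjoint.le_of_opNorm_le (c := 1) ?_ _).trans (one_mul _).le
      rwa [LinearIsometryEquiv.norm_map]
    have h4 : ‖r k‖ ^ 2 = ‖k‖ ^ 2 - 2 * ‖V k‖ ^ 2 + ‖V.adjoint (V k)‖ ^ 2 := by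
      rw [← h1]; exact h2
    have h5 : ‖V.adjoint (V k)‖ ^ 2 ≤ ‖V k‖ ^ 2 := by gcongr
    linarith
  -- V*V n is the strong limit of the partial sums of mⱼ mⱼ* n, which lie in N by the TRO property
  -- and have norm at most ‖n‖.
  have hrN : ∀ n ∈ N, r ∘L n ∈ N := by
    intro n hn
    have : V.adjoint ∘L V ∘L n ∈ N := by
      refine hclosed (fun s => (∑ j ∈ s, m j ∘L (m j).adjoint) ∘L n) _ ‖n‖ (fun s => ?_)
        (fun s => ?_) fun x => ?_
      · rw [ContinuousLinearMap.finsetSum_comp]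
        exact N.sum_mem fun j _ => hN _ (hmN j) _ (hmN j) _ hn
      · have := norm_sum_adjoint_comp_self_le _ hy s
        simp only [ContinuousLinearMap.adjoint_adjoint] at this
        exact (ContinuousLinearMap.opNorm_comp_le _ _).trans
          (mul_le_of_le_one_left (norm_nonneg n) this)
      · have := hasSum_adjoint_columnOperator _ hy (n x)
        simpa [HasSum, sum_apply] using this
    have h2 := N.sub_mem hn this
    simpa [r, ContinuousLinearMap.sub_comp, ContinuousLinearMap.comp_assoc,
      ContinuousLinearMap.one_def] using h2
  by_contra! hne
  obtain ⟨k₀, hk₀⟩ := hne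
  have hrk : r k₀ ≠ 0 := fun h => hk₀ (sub_eq_zero.1 h).symm
  obtain ⟨n, hn, hnk⟩ : ∃ n ∈ N, n.adjoint (r k₀) ≠ 0 := by
    by_contra! h
    exact hrk (hnd _ h)
  have hn0 : 0 < ‖n‖ := norm_pos_iff.2 fun h => hnk (by simp [h])
  let n' : H →L[ℂ] K := r ∘L (((‖n‖ : ℂ)⁻¹) • n)
  have hn'N : n' ∈ N := hrN _ (N.smul_mem _ hn)
  have hn'_adj : ∀ k, n'.adjoint k = ((‖n‖ : ℂ)⁻¹) • n.adjoint (r k) := by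
    intro k
    simp only [n', ContinuousLinearMap.adjoint_comp, hr_adj, map_smulₛₗ]
    simp
  -- n' n'* ≤ r² ≤ r, so n' fits into the room left by the family.
  have hn'_norm : ∀ k, ‖n'.adjoint k‖ ^ 2 ≤ ‖k‖ ^ 2 - ‖V k‖ ^ 2 := by
    intro k
    refine le_trans ?_ (hr_norm k)
    gcongr
    rw [hn'_adj, norm_smul, norm_inv, Complex.norm_real, norm_norm, inv_mul_le_iff₀ hn0]
    exact n.adjoint.le_of_opNorm_le (by rw [LinearIsometryEquiv.norm_map]) _
  have hn'0 : n'.adjoint k₀ ≠ 0 := by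
    rw [hn'_adj]
    exact smul_ne_zero (inv_ne_zero (by exact_mod_cast hn0.ne')) hnk
  -- If every copy of n' were in S, then i ‖n'* k₀‖² ≤ ‖k₀‖² for all i.
  obtain ⟨i, hi⟩ : ∃ i : ℕ, (n', i) ∉ S := by
    by_contra! h
    obtain ⟨i, hi⟩ := exists_nat_gt (‖k₀‖ ^ 2 / ‖n'.adjoint k₀‖ ^ 2)
    rw [div_lt_iff₀ (by positivity)] at hi
    have := hS.prop.2 ({n'} ×ˢ Finset.range i) (by
      rintro ⟨a, b⟩ hj
      obtain rfl : a = n' := by simpa using (Finset.mem_product.1 hj).1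
      exact h b) k₀
    rw [Finset.sum_product, Finset.sum_singleton] at this
    change ∑ _y ∈ Finset.range i, ‖n'.adjoint k₀‖ ^ 2 ≤ _ at this
    rw [Finset.sum_const, Finset.card_range, nsmul_eq_mul] at this
    linarith
  refine hi (hS.le_of_ge (y := insert (n', i) S) ⟨?_, ?_⟩ (Set.subset_insert _ _)
    (Set.mem_insert _ _))
  · rintro j (rfl | hj)
    · exact hn'N
    · exact hS.prop.1 j hj
  · intro s hs k
    have h1 : ∑ j ∈ s.erase (n', i), ‖j.1.adjoint k‖ ^ 2 ≤ ‖V k‖ ^ 2 := by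
      refine le_trans (le_of_eq ?_)
        (sum_le_hasSum (s.erase (n', i)) (fun _ _ => by positivity)
          (hasSum_norm_sq_columnOperator _ hy k))
      refine Finset.sum_congr rfl fun j hj => ?_
      rw [Finset.mem_erase] at hj
      have : j ∈ S := (hs hj.2).resolve_left hj.1
      simp [m, this]
    have h2 : ∑ j ∈ s, ‖j.1.adjoint k‖ ^ 2 ≤
        ‖n'.adjoint k‖ ^ 2 + ∑ j ∈ s.erase (n', i), ‖j.1.adjoint k‖ ^ 2 := by
      by_cases h : (n', i) ∈ s
      · rw [← Finset.add_sum_erase _ _ h]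
      · rw [Finset.erase_eq_of_notMem h]
        exact le_add_of_nonneg_left (by positivity)
    have h3 := hn'_norm k
    linarith

end Exhaustion

/-! ### Schröder–Bernstein for isometries in a w*-closed TRO. -/

section Bernstein

open Filter Topology

variable {H K : Type*}
  [NormedAddCommGroup H] [InnerProductSpace ℂ H] [CompleteSpace H]
  [NormedAddCommGroup K] [InnerProductSpace ℂ K] [CompleteSpace K]

theorem exists_limit_of_monotone_isStarProjection {e : ℕ → H →L[ℂ] H}
    (he : ∀ n, IsStarProjection (e n)) (hmono : ∀ n, e (n + 1) * e n = e n) :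
    ∃ f : H →L[ℂ] H, IsStarProjection f ∧ ∀ x, Tendsto (fun n => e n x) atTop (𝓝 (f x)) := by
  have h1 := fun n => isStarProjection_iff_eq_starProjection_range.1 (he n)
  choose hp hproj using h1
  have hU : Monotone fun n => (e n).range := by
    refine monotone_nat_of_le_succ fun n => ?_
    rintro _ ⟨x, rfl⟩
    exact ⟨e n x, congrArg (fun T : H →L[ℂ] H => T x) (hmono n)⟩
  refine ⟨(⨆ n, (e n).range).topologicalClosure.starProjection, isStarProjection_starProjection,
    fun x => ?_⟩
  have := Submodule.starProjection_tendsto_closure_iSup (fun n => (e n).range) hU x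
  refine this.congr fun n => ?_
  conv_rhs => rw [hproj n]

/-- As for sets: with p = w v and p₀ = 1 - w w*, let f = ∑ pⁿ p₀ p*ⁿ, the projection onto what
arises from the complement of the range of w under iteration of p. The unitary is v on the range of
f and w* on its complement. -/
theorem exists_unitary_of_isometries {N : Submodule ℂ (H →L[ℂ] K)} (hN : IsTRO N)
    (hclosed : IsWeakStarClosed (N : Set (H →L[ℂ] K)))
    (V : H →ₗᵢ[ℂ] K) (hV : V.toContinuousLinearMap ∈ N)
    (W : K →ₗᵢ[ℂ] H) (hW : W.toContinuousLinearMap.adjoint ∈ N) :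
    ∃ U : H ≃ₗᵢ[ℂ] K, (U : H →L[ℂ] K) ∈ N := by
  set v : H →L[ℂ] K := V.toContinuousLinearMap with hv
  set w : K →L[ℂ] H := W.toContinuousLinearMap with hw
  have hvv : ∀ x, v.adjoint (v x) = x := fun x => by
    refine ext_inner_right ℂ fun z => ?_
    rw [ContinuousLinearMap.adjoint_inner_left]
    exact V.inner_map_map _ _
  have hww : ∀ x, w.adjoint (w x) = x := fun x => by
    refine ext_inner_right ℂ fun z => ?_
    rw [ContinuousLinearMap.adjoint_inner_left]
    exact W.inner_map_map _ _
  let p : H →L[ℂ] H := w ∘L v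
  let p₀ : H →L[ℂ] H := 1 - w ∘L w.adjoint
  -- The partial sums of the series for f, written recursively so that the limit satisfies f = p₀ +
  -- p f p*.
  let e : ℕ → H →L[ℂ] H := fun n => Nat.rec 0 (fun _ e => p₀ + p ∘L e ∘L p.adjoint) n
  have he0 : e 0 = 0 := rfl
  have hes : ∀ n, e (n + 1) = p₀ + p ∘L e n ∘L p.adjoint := fun n => rfl
  have hp₀w : ∀ x, p₀ (w x) = 0 := fun x => by simp [p₀, hww]
  have hwp₀ : ∀ x, w.adjoint (p₀ x) = 0 := fun x => by simp [p₀, hww]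
  have hp₀p₀ : ∀ x, p₀ (p₀ x) = p₀ x := fun x => by
    conv_lhs => rw [show p₀ (p₀ x) = p₀ x - w (w.adjoint (p₀ x)) from rfl, hwp₀]
    simp
  have hp₀p : ∀ x, p₀ (p x) = 0 := fun x => hp₀w _
  have hpp : ∀ x, p.adjoint (p x) = x := fun x => by
    simp [p, ContinuousLinearMap.adjoint_comp, hww, hvv]
  have hpp₀ : ∀ x, p.adjoint (p₀ x) = 0 := fun x => by
    simp [p, ContinuousLinearMap.adjoint_comp, hwp₀]
  have hp₀sa : p₀.adjoint = p₀ := by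
    simp only [p₀, map_sub, ContinuousLinearMap.adjoint_comp, ContinuousLinearMap.adjoint_adjoint]
    congr 1
    exact ContinuousLinearMap.adjoint_id
  have hmul : ∀ n, e n ∘L e n = e n := by
    intro n
    induction n with
    | zero => simp [he0]
    | succ n ih =>
      ext x
      have := congrArg (fun T : H →L[ℂ] H => T (p.adjoint x)) ih
      simp only [ContinuousLinearMap.comp_apply] at this
      simp [hes, hp₀p₀, hp₀p, hpp, hpp₀, this]
  have hsa : ∀ n, (e n).adjoint = e n := by
    intro n
    induction n with
    | zero => simp [he0]
    | succ n ih =>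
      simp [hes, ContinuousLinearMap.adjoint_comp, ih, hp₀sa, ContinuousLinearMap.comp_assoc]
  have hproj : ∀ n, IsStarProjection (e n) := fun n => ⟨hmul n, hsa n⟩
  have hmono : ∀ n, e (n + 1) * e n = e n := by
    intro n
    induction n with
    | zero => simp [he0]
    | succ n ih =>
      ext x
      have : e (n + 1) (e n (p.adjoint x)) = e n (p.adjoint x) :=
        congrArg (fun T : H →L[ℂ] H => T (p.adjoint x)) ih
      have h1 : e (n + 1) x = p₀ x + p (e n (p.adjoint x)) := rfl
      have h2 : ∀ y, e (n + 1 + 1) y = p₀ y + p (e (n + 1) (p.adjoint y)) := fun _ => rfl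
      change e (n + 1 + 1) (e (n + 1) x) = e (n + 1) x
      rw [h2, h1]
      simp [hp₀p₀, hp₀p, hpp, hpp₀, this]
  obtain ⟨f, hf, hlim⟩ := exists_limit_of_monotone_isStarProjection hproj hmono
  have hff : ∀ x, f (f x) = f x := fun x =>
    congrArg (fun T : H →L[ℂ] H => T x) hf.isIdempotentElem
  have hfsa : f.adjoint = f := hf.isSelfAdjoint
  have hfix : ∀ x, f x = p₀ x + p (f (p.adjoint x)) := by
    intro x
    refine tendsto_nhds_unique ((tendsto_add_atTop_iff_nat 1).2 (hlim x)) ?_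
    simp only [hes]
    exact ((p.continuous.tendsto _).comp (hlim (p.adjoint x))).const_add _
  have hfp : ∀ x, f (p x) = p (f x) := fun x => by rw [hfix, hp₀p, hpp, zero_add]
  have hfp₀ : ∀ x, f (p₀ x) = p₀ x := fun x => by rw [hfix, hpp₀, hp₀p₀]; simp
  have hwf : ∀ x, w.adjoint (f x) = v (f (p.adjoint x)) := fun x => by
    rw [hfix, map_add, hwp₀, zero_add]
    exact hww _
  have hvw : ∀ x, v (p.adjoint x) = v (v.adjoint (w.adjoint x)) := fun x => by
    simp [p, ContinuousLinearMap.adjoint_comp]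
  have hvp₀ : v ∘L p₀ ∈ N := by
    have h1 := hN _ hV _ hW _ hW
    rw [ContinuousLinearMap.adjoint_adjoint] at h1
    convert N.sub_mem hV h1 using 1
    ext x
    simp [p₀]
  -- Although e n acts on H, v e n lies in N: v p e p* = (v w (v e)) v* w* is a nested triple
  -- product of v, w* and v e.
  have hve : ∀ n, v ∘L e n ∈ N := by
    intro n
    induction n with
    | zero => simp [he0]
    | succ n ih =>
      have h1 := hN _ (hN _ hV _ hW _ ih) _ hV _ hW
      convert N.add_mem hvp₀ h1 using 1
      ext x
      simp [hes, p, ContinuousLinearMap.adjoint_comp]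
  have hvf : v ∘L f ∈ N := by
    refine hclosed.mem_of_tendsto (l := atTop) (T := fun n => v ∘L e n) (C := ‖v‖) hve
      (fun n => ?_) fun x y => ?_
    · exact (ContinuousLinearMap.opNorm_comp_le _ _).trans
        (mul_le_of_le_one_right (norm_nonneg v) ((hproj n).norm_le))
    · exact tendsto_const_nhds.inner ((v.continuous.tendsto _).comp (hlim x))
  -- This is v f + w* (1 - f), with w* f rewritten as v f v* w* to make membership in N visible.
  let U : H →L[ℂ] K := v ∘L f + w.adjoint - v ∘L f ∘L v.adjoint ∘L w.adjoint
  have hUN : U ∈ N := N.sub_mem (N.add_mem hvf hW) (hN _ hvf _ hV _ hW)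
  have hU : ∀ x, U x = v (f x) + w.adjoint (x - f x) := fun x => by
    rw [map_sub, hwf]
    simp [U, p, ContinuousLinearMap.adjoint_comp, add_sub_assoc]
  let U' : K →L[ℂ] H := f ∘L v.adjoint + w - f ∘L w
  have hU' : ∀ y, U' y = f (v.adjoint y) + (w y - f (w y)) := fun y => by
    simp [U', add_sub_assoc]
  have hwf' : ∀ y, w.adjoint (f (w y)) = v (f (v.adjoint y)) := fun y => by
    rw [hwf]
    simp [p, ContinuousLinearMap.adjoint_comp, hww]
  have hfwv : ∀ x, f (w (v x)) = w (v (f x)) := hfp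
  have hUU' : ∀ y, U (U' y) = y := fun y => by
    rw [hU, hU']
    simp [hff, hww, hwf']
  have hww' : ∀ x, w (w.adjoint x) = x - p₀ x := fun x => by simp [p₀]
  have hU'U : ∀ x, U' (U x) = x := fun x => by
    rw [hU', hU]
    simp only [map_add, map_sub, hvv, hww', hfwv, hff, hfp₀]
    have h1 : f (v.adjoint (w.adjoint x)) = f (v.adjoint (w.adjoint (f x))) := by
      rw [hwf, hvv]
      simp [p, ContinuousLinearMap.adjoint_comp, hff]
    have h2 : p₀ (f x) = p₀ x := by
      rw [hfix, map_add, hp₀p₀, hp₀p, add_zero]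
    simp [h1, h2]
  have hadj : U.adjoint = U' := by
    simp only [U, U', map_add, map_sub, ContinuousLinearMap.adjoint_comp,
      ContinuousLinearMap.adjoint_adjoint, hfsa]
    congr 1
    ext y
    simp [hfix (w y), hp₀w, p, ContinuousLinearMap.adjoint_comp, hww]
  have hnorm : ∀ x, ‖U x‖ = ‖x‖ := fun x => by
    have h : ⟪U.adjoint (U x), x⟫_ℂ = ⟪U x, U x⟫_ℂ := U.adjoint_inner_left _ _
    rw [hadj, hU'U, inner_self_eq_norm_sq_to_K, inner_self_eq_norm_sq_to_K] at h
    have h' : ‖x‖ ^ 2 = ‖U x‖ ^ 2 := by exact_mod_cast h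
    exact ((sq_eq_sq₀ (norm_nonneg _) (norm_nonneg _)).1 h').symm
  refine ⟨⟨⟨U.toLinearMap, U', hU'U, hUU'⟩, hnorm⟩, ?_⟩
  exact hUN

end Bernstein

/-! ### Algebra and continuity of x ⊗ y. -/

section OpTensor

open Filter Topology

variable {H₁ H₂ H₃ K₁ K₂ K₃ : Type*}
  [NormedAddCommGroup H₁] [InnerProductSpace ℂ H₁]
  [NormedAddCommGroup H₂] [InnerProductSpace ℂ H₂]
  [NormedAddCommGroup H₃] [InnerProductSpace ℂ H₃]
  [NormedAddCommGroup K₁] [InnerProductSpace ℂ K₁]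
  [NormedAddCommGroup K₂] [InnerProductSpace ℂ K₂]
  [NormedAddCommGroup K₃] [InnerProductSpace ℂ K₃]

theorem opTensor_coe (x : H₁ →L[ℂ] H₂) (y : K₁ →L[ℂ] K₂) (z : H₁ ⊗[ℂ] K₁) :
    opTensor x y z = (TensorProduct.mapL x y z : HilbertTensor H₂ K₂) :=
  ContinuousLinearMap.completion_apply_coe _ _

theorem hilbertTensor_ext {E : Type*} [NormedAddCommGroup E] [NormedSpace ℂ E]
    {S T : HilbertTensor H₁ K₁ →L[ℂ] E}
    (h : ∀ z : H₁ ⊗[ℂ] K₁, S (z : HilbertTensor H₁ K₁) = T (z : HilbertTensor H₁ K₁)) :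
    S = T := by
  ext z
  exact UniformSpace.Completion.induction_on z (isClosed_eq S.continuous T.continuous) h

theorem opTensor_comp (x : H₂ →L[ℂ] H₃) (x' : H₁ →L[ℂ] H₂) (y : K₂ →L[ℂ] K₃) (y' : K₁ →L[ℂ] K₂) :
    opTensor (x ∘L x') (y ∘L y') = opTensor x y ∘L opTensor x' y' := by
  refine hilbertTensor_ext fun z => ?_
  rw [ContinuousLinearMap.comp_apply, opTensor_coe, opTensor_coe, opTensor_coe,
    TensorProduct.mapL_comp, ContinuousLinearMap.comp_apply]

theorem opTensor_one_one : opTensor (1 : H₁ →L[ℂ] H₁) (1 : K₁ →L[ℂ] K₁) = 1 := by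
  refine hilbertTensor_ext fun z => ?_
  rw [opTensor_coe, ContinuousLinearMap.one_def, ContinuousLinearMap.one_def,
    TensorProduct.mapL_id_id]
  rfl

theorem opTensor_zero_right (x : H₁ →L[ℂ] H₂) : opTensor x (0 : K₁ →L[ℂ] K₂) = 0 := by
  refine hilbertTensor_ext fun z => ?_
  rw [opTensor_coe, TensorProduct.mapL_zero_right]
  exact UniformSpace.Completion.coe_zero

/-- The linear map `x ↦ x ⊗ y`. -/
noncomputable def opTensorLeft (y : K₁ →L[ℂ] K₂) :
    (H₁ →L[ℂ] H₂) →ₗ[ℂ] (HilbertTensor H₁ K₁ →L[ℂ] HilbertTensor H₂ K₂) where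
  toFun x := opTensor x y
  map_add' x x' := by
    refine hilbertTensor_ext fun z => ?_
    rw [add_apply, opTensor_coe, opTensor_coe, opTensor_coe,
      TensorProduct.mapL_add_left, add_apply, UniformSpace.Completion.coe_add]
  map_smul' c x := by
    refine hilbertTensor_ext fun z => ?_
    rw [smul_apply, opTensor_coe, opTensor_coe, TensorProduct.mapL_smul_left, smul_apply,
      UniformSpace.Completion.coe_smul]
    rfl

theorem opTensorLeft_apply (x : H₁ →L[ℂ] H₂) (y : K₁ →L[ℂ] K₂) :
    opTensorLeft y x = opTensor x y := rfl

theorem norm_opTensor_le (x : H₁ →L[ℂ] H₂) (y : K₁ →L[ℂ] K₂) :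
    ‖opTensor x y‖ ≤ ‖x‖ * ‖y‖ := by
  refine ContinuousLinearMap.opNorm_le_bound _ (by positivity) fun z => ?_
  refine UniformSpace.Completion.induction_on z
    (isClosed_le (opTensor x y).continuous.norm (continuous_const.mul continuous_norm)) fun z => ?_
  rw [opTensor_coe, UniformSpace.Completion.norm_coe, UniformSpace.Completion.norm_coe]
  exact ContinuousLinearMap.le_of_opNorm_le _ (TensorProduct.norm_mapL_le x y) z

theorem adjoint_opTensor [CompleteSpace H₁] [CompleteSpace H₂] [CompleteSpace K₁]
    [CompleteSpace K₂] (x : H₁ →L[ℂ] H₂) (y : K₁ →L[ℂ] K₂) :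
    (opTensor x y).adjoint = opTensor x.adjoint y.adjoint := by
  refine (ContinuousLinearMap.eq_adjoint_iff _ _).2 (fun z w => ?_) |>.symm
  refine UniformSpace.Completion.induction_on₂ z w (isClosed_eq (by fun_prop) (by fun_prop))
    fun z w => ?_
  rw [opTensor_coe, opTensor_coe, UniformSpace.Completion.inner_coe,
    UniformSpace.Completion.inner_coe]
  induction z with
  | zero => simp
  | add z z' hz hz' => rw [map_add, inner_add_left, inner_add_left, hz, hz']
  | tmul a b =>
    induction w with
    | zero => simp
    | add w w' hw hw' => rw [map_add, inner_add_right, inner_add_right, hw, hw']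
    | tmul c d => simp [ContinuousLinearMap.adjoint_inner_left]

/-- A bounded family is equicontinuous, so convergence on the algebraic tensor product extends to
its completion. -/
theorem isClosed_setOf_tendsto_of_norm_le {E F ι : Type*} [NormedAddCommGroup E]
    [NormedSpace ℂ E] [NormedAddCommGroup F] [NormedSpace ℂ F] {l : Filter ι}
    {T : ι → E →L[ℂ] F} (T₀ : E →L[ℂ] F) {C : ℝ} (hC : ∀ i, ‖T i‖ ≤ C) :
    IsClosed {z | Tendsto (fun i => T i z) l (𝓝 (T₀ z))} :=
  Equicontinuous.isClosed_setOfPred_tendsto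
    (((NormedSpace.equicontinuous_TFAE T).out 5 1 :
      (∃ C, ∀ i, ‖T i‖ ≤ C) ↔ Equicontinuous fun i x => T i x).1 ⟨C, hC⟩) T₀.continuous

theorem tendsto_opTensor {ι : Type*} {l : Filter ι} {T : ι → H₁ →L[ℂ] H₂} {T₀ : H₁ →L[ℂ] H₂}
    {C : ℝ} (hC : ∀ i, ‖T i‖ ≤ C) (h : ∀ x, Tendsto (fun i => T i x) l (𝓝 (T₀ x)))
    (y : K₁ →L[ℂ] K₂) (z : HilbertTensor H₁ K₁) :
    Tendsto (fun i => opTensor (T i) y z) l (𝓝 (opTensor T₀ y z)) := by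
  refine UniformSpace.Completion.induction_on z
    (isClosed_setOf_tendsto_of_norm_le (T := fun i => opTensor (T i) y) _ (C := C * ‖y‖)
      fun i => (norm_opTensor_le _ _).trans (by gcongr; exact hC i)) fun z => ?_
  simp only [opTensor_coe]
  refine (UniformSpace.Completion.continuous_coe _).continuousAt.tendsto.comp ?_
  induction z with
  | zero => simpa only [map_zero] using tendsto_const_nhds
  | add z z' hz hz' => simpa only [map_add] using hz.add hz'
  | tmul a b =>
    simp only [TensorProduct.mapL_tmul]
    exact (TensorProduct.continuous_tmul.tendsto (T₀ a, y b)).comp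
      ((h a).prodMk_nhds tendsto_const_nhds)

end OpTensor

/-! ### The spaces X ⊗̄ M_J and their products. -/

section NormalTensor

open Filter Topology

variable {H₁ H₂ H₃ H₄ : Type*} {J : Type*}
  [NormedAddCommGroup H₁] [InnerProductSpace ℂ H₁] [CompleteSpace H₁]
  [NormedAddCommGroup H₂] [InnerProductSpace ℂ H₂] [CompleteSpace H₂]
  [NormedAddCommGroup H₃] [InnerProductSpace ℂ H₃] [CompleteSpace H₃]
  [NormedAddCommGroup H₄] [InnerProductSpace ℂ H₄] [CompleteSpace H₄]

variable (J) in
/-- The normal spatial tensor product `X ⊗̄ M_J` as a subspace. -/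
noncomputable def normalTensorSubmodule (X : Set (H₁ →L[ℂ] H₂)) :
    Submodule ℂ (HilbertTensor H₁ (EllTwo J) →L[ℂ] HilbertTensor H₂ (EllTwo J)) :=
  weakStarSubmodule {T | ∃ x ∈ X, ∃ y ∈ matrixOps J, T = opTensor x y}

theorem mem_normalTensorSubmodule {X : Set (H₁ →L[ℂ] H₂)}
    {T : HilbertTensor H₁ (EllTwo J) →L[ℂ] HilbertTensor H₂ (EllTwo J)} :
    T ∈ normalTensorSubmodule J X ↔ T ∈ normalTensor X (matrixOps J) := Iff.rfl

theorem opTensor_mem_normalTensorSubmodule {X : Set (H₁ →L[ℂ] H₂)} {x : H₁ →L[ℂ] H₂} (hx : x ∈ X)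
    (y : EllTwo J →L[ℂ] EllTwo J) : opTensor x y ∈ normalTensorSubmodule J X :=
  subset_weakStarSubmodule _ ⟨x, hx, y, Set.mem_univ _, rfl⟩

theorem comp_mem_normalTensorSubmodule {X : Set (H₂ →L[ℂ] H₃)} {Y : Set (H₁ →L[ℂ] H₂)}
    {Z : Set (H₁ →L[ℂ] H₃)} (h : ∀ x ∈ X, ∀ y ∈ Y, x ∘L y ∈ Z)
    {S : HilbertTensor H₂ (EllTwo J) →L[ℂ] HilbertTensor H₃ (EllTwo J)}
    (hS : S ∈ normalTensorSubmodule J X)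
    {T : HilbertTensor H₁ (EllTwo J) →L[ℂ] HilbertTensor H₂ (EllTwo J)}
    (hT : T ∈ normalTensorSubmodule J Y) : S ∘L T ∈ normalTensorSubmodule J Z := by
  refine comp_mem_weakStarSubmodule ?_ hS hT
  rintro _ ⟨x, hx, a, -, rfl⟩ _ ⟨y, hy, b, -, rfl⟩
  rw [← opTensor_comp]
  exact opTensor_mem_normalTensorSubmodule (h x hx y hy) _

theorem comp_comp_mem_normalTensorSubmodule {X : Set (H₃ →L[ℂ] H₄)} {Y : Set (H₂ →L[ℂ] H₃)}
    {Z : Set (H₁ →L[ℂ] H₂)} {W : Set (H₁ →L[ℂ] H₄)}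
    (h : ∀ x ∈ X, ∀ y ∈ Y, ∀ z ∈ Z, x ∘L y ∘L z ∈ W)
    {R : HilbertTensor H₃ (EllTwo J) →L[ℂ] HilbertTensor H₄ (EllTwo J)}
    (hR : R ∈ normalTensorSubmodule J X)
    {S : HilbertTensor H₂ (EllTwo J) →L[ℂ] HilbertTensor H₃ (EllTwo J)}
    (hS : S ∈ normalTensorSubmodule J Y)
    {T : HilbertTensor H₁ (EllTwo J) →L[ℂ] HilbertTensor H₂ (EllTwo J)}
    (hT : T ∈ normalTensorSubmodule J Z) : R ∘L S ∘L T ∈ normalTensorSubmodule J W := by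
  have hST : S ∘L T ∈ normalTensorSubmodule J (Set.image2 (fun y z => y ∘L z) Y Z) :=
    comp_mem_normalTensorSubmodule (fun y hy z hz => Set.mem_image2_of_mem hy hz) hS hT
  refine comp_mem_normalTensorSubmodule ?_ hR hST
  rintro x hx _ ⟨y, hy, z, hz, rfl⟩
  exact h x hx y hy z hz

theorem adjoint_mem_normalTensorSubmodule {X : Set (H₁ →L[ℂ] H₂)} {Y : Set (H₂ →L[ℂ] H₁)}
    (h : ∀ x ∈ X, x.adjoint ∈ Y)
    {S : HilbertTensor H₁ (EllTwo J) →L[ℂ] HilbertTensor H₂ (EllTwo J)}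
    (hS : S ∈ normalTensorSubmodule J X) : S.adjoint ∈ normalTensorSubmodule J Y := by
  refine adjoint_mem_weakStarSubmodule ?_ hS
  rintro _ ⟨x, hx, a, -, rfl⟩
  rw [adjoint_opTensor]
  exact opTensor_mem_normalTensorSubmodule (h x hx) _

theorem IsTRO.normalTensorSubmodule {M : Submodule ℂ (H₁ →L[ℂ] H₂)} (hM : IsTRO M) :
    IsTRO (normalTensorSubmodule J (M : Set (H₁ →L[ℂ] H₂))) := by
  intro a ha b hb c hc
  refine comp_comp_mem_normalTensorSubmodule
    (Y := ContinuousLinearMap.adjoint '' (M : Set (H₁ →L[ℂ] H₂))) ?_ ha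
    (adjoint_mem_normalTensorSubmodule (fun x hx => Set.mem_image_of_mem _ hx) hb) hc
  rintro x hx _ ⟨y, hy, rfl⟩ z hz
  exact hM x hx y hy z hz

end NormalTensor

/-! ### From columns to isometries, and block isometries of ℓ²_J. -/

section Isometry

open Filter Topology

variable {J : Type*}

theorem hasSum_adjoint_apply_of_hasSum_norm_sq {E F : Type*}
    [NormedAddCommGroup E] [InnerProductSpace ℂ E] [CompleteSpace E]
    [NormedAddCommGroup F] [InnerProductSpace ℂ F] [CompleteSpace F] {y : J → E →L[ℂ] F}
    (hy : ∀ x, HasSum (fun j => ‖y j x‖ ^ 2) (‖x‖ ^ 2)) (x : E) :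
    HasSum (fun j => (y j).adjoint (y j x)) x := by
  have hle := fun (s : Finset J) (x : E) => sum_le_hasSum s (fun _ _ => by positivity) (hy x)
  have hV : ∀ x, ‖columnOperator y hle x‖ = ‖x‖ := fun x =>
    (sq_eq_sq₀ (norm_nonneg _) (norm_nonneg _)).1
      ((hasSum_norm_sq_columnOperator y hle x).unique (hy x))
  have h1 := (ContinuousLinearMap.norm_map_iff_adjoint_comp_self _).1 hV
  have h2 := hasSum_adjoint_columnOperator y hle x
  rwa [← ContinuousLinearMap.comp_apply, h1] at h2

variable {H K : Type*}
  [NormedAddCommGroup H] [InnerProductSpace ℂ H] [CompleteSpace H]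
  [NormedAddCommGroup K] [InnerProductSpace ℂ K] [CompleteSpace K]

/-- W = ∑ Sⱼ xⱼ* is isometric because the ranges of the Sⱼ are orthogonal; W* is the weak limit of
the contractions ∑ xⱼ Sⱼ* over finite sets, all in N. -/
theorem exists_isometry_of_column {N : Submodule ℂ (H →L[ℂ] K)}
    (hclosed : IsWeakStarClosed (N : Set (H →L[ℂ] K))) {x : J → H →L[ℂ] K}
    (hx : ∀ k, HasSum (fun j => ‖(x j).adjoint k‖ ^ 2) (‖k‖ ^ 2))
    {S : J → H →ₗᵢ[ℂ] H} (hS : OrthogonalFamily ℂ (fun _ => H) S)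
    (hxS : ∀ j, x j ∘L (S j).toContinuousLinearMap.adjoint ∈ N) :
    ∃ W : K →ₗᵢ[ℂ] H, W.toContinuousLinearMap.adjoint ∈ N := by
  have hle := fun (s : Finset J) (k : K) => sum_le_hasSum s (fun _ _ => by positivity) (hx k)
  let V : K →ₗᵢ[ℂ] lp (fun _ : J => H) 2 :=
    ⟨(columnOperator (fun j => (x j).adjoint) hle).toLinearMap, fun k =>
      (sq_eq_sq₀ (norm_nonneg _) (norm_nonneg _)).1
        ((hasSum_norm_sq_columnOperator _ hle k).unique (hx k))⟩
  let W := hS.linearIsometry.comp V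
  have hW : ∀ k, HasSum (fun j => S j ((x j).adjoint k)) (W k) := fun k =>
    hS.hasSum_linearIsometry (V k)
  have hadj : ∀ (s : Finset J) (k : K) (h : H),
      ⟪k, (∑ j ∈ s, x j ∘L (S j).toContinuousLinearMap.adjoint) h⟫_ℂ =
        ⟪∑ j ∈ s, S j ((x j).adjoint k), h⟫_ℂ := by
    intro s k h
    simp only [sum_apply, inner_sum, sum_inner, ContinuousLinearMap.comp_apply]
    refine Finset.sum_congr rfl fun j _ => ?_
    rw [← ContinuousLinearMap.adjoint_inner_left, ContinuousLinearMap.adjoint_inner_right]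
    rfl
  refine ⟨W, hclosed.mem_of_tendsto (l := atTop)
    (T := fun s : Finset J => ∑ j ∈ s, x j ∘L (S j).toContinuousLinearMap.adjoint) (C := 1)
    (fun s => N.sum_mem fun j _ => hxS j) (fun s => ?_) fun h k => ?_⟩
  · refine ContinuousLinearMap.opNorm_le_of_re_inner_le zero_le_one fun h k hh hk => ?_
    have h1 : ‖∑ j ∈ s, S j ((x j).adjoint k)‖ ≤ ‖k‖ := by
      refine (sq_le_sq₀ (norm_nonneg _) (norm_nonneg _)).1 ?_
      rw [hS.norm_sum]
      exact hle s k
    rw [inner_re_symm, hadj]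
    calc _ ≤ ‖∑ j ∈ s, S j ((x j).adjoint k)‖ * ‖h‖ :=
          (RCLike.re_le_norm _).trans (norm_inner_le_norm _ _)
      _ ≤ 1 := by rw [hh, mul_one]; exact h1.trans hk.le
  · simp only [hadj, ContinuousLinearMap.adjoint_inner_right]
    exact Tendsto.inner (hW k) tendsto_const_nhds

theorem orthonormal_lp_single (J : Type*) [DecidableEq J] :
    Orthonormal ℂ fun j : J => (lp.single 2 j (1 : ℂ) : EllTwo J) := by
  rw [orthonormal_iff_ite]
  intro i j
  rw [lp.inner_single_left, lp.single_apply]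
  by_cases h : i = j
  · subst h; simp
  · simp [h]

/-- The isometry of `ℓ²_J` onto the span of the basis vectors with indices in the `i`-th block. -/
noncomputable def blockIsometry [DecidableEq J] (e : J × J ≃ J) (i : J) :
    EllTwo J →ₗᵢ[ℂ] EllTwo J :=
  ((orthonormal_lp_single J).comp (fun j => e (i, j))
    fun _ _ h => (Prod.ext_iff.1 (e.injective h)).2).orthogonalFamily.linearIsometry

theorem inner_blockIsometry_of_ne [DecidableEq J] (e : J × J ≃ J) {i i' : J} (hi : i ≠ i')
    (x y : EllTwo J) : ⟪blockIsometry e i x, blockIsometry e i' y⟫_ℂ = 0 := by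
  have hx := OrthogonalFamily.hasSum_linearIsometry ((orthonormal_lp_single J).comp
    (fun j => e (i, j)) fun _ _ h => (Prod.ext_iff.1 (e.injective h)).2).orthogonalFamily x
  have hy := OrthogonalFamily.hasSum_linearIsometry ((orthonormal_lp_single J).comp
    (fun j => e (i', j)) fun _ _ h => (Prod.ext_iff.1 (e.injective h)).2).orthogonalFamily y
  refine ((hx.mapL ((innerSL ℂ).flip (blockIsometry e i' y))).unique ?_)
  convert hasSum_zero with j
  refine (hy.mapL (innerSL ℂ _)).unique ?_
  convert hasSum_zero with j'
  have hne : e (i, j) ≠ e (i', j') := fun h => hi (Prod.ext_iff.1 (e.injective h)).1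
  have h0 : ⟪(lp.single 2 (e (i, j)) (1 : ℂ) : EllTwo J), lp.single 2 (e (i', j')) (1 : ℂ)⟫_ℂ = 0 :=
    (orthonormal_lp_single J).2 hne
  simp [h0]

end Isometry

/-! ### Amplification of columns and the main theorem. -/

section Main

open Filter Topology

variable {H K : Type*} {J : Type*}
  [NormedAddCommGroup H] [InnerProductSpace ℂ H] [CompleteSpace H]
  [NormedAddCommGroup K] [InnerProductSpace ℂ K] [CompleteSpace K]

theorem adjoint_one_eq : (1 : H →L[ℂ] H).adjoint = 1 :=
  ContinuousLinearMap.adjoint_id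

/-- The bounded partial sums of mⱼ mⱼ* tend strongly to 1, and tensoring with 1 preserves this;
pairing with z gives the norms. -/
theorem hasSum_norm_sq_adjoint_opTensor_one {L : Type*} [NormedAddCommGroup L]
    [InnerProductSpace ℂ L] [CompleteSpace L] {m : J → H →L[ℂ] K}
    (hm : ∀ k, HasSum (fun j => ‖(m j).adjoint k‖ ^ 2) (‖k‖ ^ 2)) (z : HilbertTensor K L) :
    HasSum (fun j => ‖(opTensor (m j) (1 : L →L[ℂ] L)).adjoint z‖ ^ 2) (‖z‖ ^ 2) := by
  have hle := fun (s : Finset J) (k : K) => sum_le_hasSum s (fun _ _ => by positivity) (hm k)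
  have hb := norm_sum_adjoint_comp_self_le _ hle
  have hsum := hasSum_adjoint_apply_of_hasSum_norm_sq hm
  simp only [ContinuousLinearMap.adjoint_adjoint] at hb hsum
  have ht : Tendsto (fun s => opTensor (∑ j ∈ s, m j ∘L (m j).adjoint) (1 : L →L[ℂ] L) z) atTop
      (𝓝 (opTensor (1 : K →L[ℂ] K) (1 : L →L[ℂ] L) z)) :=
    tendsto_opTensor hb (fun k => by simpa [HasSum] using hsum k) 1 z
  have hsplit : ∀ s : Finset J, opTensor (∑ j ∈ s, m j ∘L (m j).adjoint) (1 : L →L[ℂ] L) =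
      ∑ j ∈ s, opTensor (m j) (1 : L →L[ℂ] L) ∘L (opTensor (m j) (1 : L →L[ℂ] L)).adjoint := by
    intro s
    rw [← opTensorLeft_apply, map_sum]
    refine Finset.sum_congr rfl fun j _ => ?_
    rw [opTensorLeft_apply, adjoint_opTensor, ← opTensor_comp, adjoint_one_eq]
    rfl
  rw [opTensor_one_one] at ht
  have ht2 := (Complex.continuous_re.tendsto _).comp
    (Tendsto.inner (𝕜 := ℂ) (tendsto_const_nhds (x := z)) ht)
  have hz : (⟪z, (1 : HilbertTensor K L →L[ℂ] HilbertTensor K L) z⟫_ℂ).re = ‖z‖ ^ 2 :=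
    inner_self_eq_norm_sq (𝕜 := ℂ) z
  rw [hz] at ht2
  refine ht2.congr fun s => ?_
  rw [Function.comp_apply, hsplit, sum_apply, inner_sum, Complex.re_sum]
  refine Finset.sum_congr rfl fun j _ => ?_
  rw [ContinuousLinearMap.comp_apply]
  refine Eq.trans ?_ (inner_self_eq_norm_sq (𝕜 := ℂ) _)
  exact congrArg Complex.re (ContinuousLinearMap.adjoint_inner_left _ _ _).symm

theorem inner_opTensor_one_opTensor_one {L : Type*} [NormedAddCommGroup L]
    [InnerProductSpace ℂ L] [CompleteSpace L] (s t : L →L[ℂ] L) (x y : HilbertTensor H L) :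
    ⟪opTensor (1 : H →L[ℂ] H) s x, opTensor (1 : H →L[ℂ] H) t y⟫_ℂ =
      ⟪x, opTensor (1 : H →L[ℂ] H) (s.adjoint ∘L t) y⟫_ℂ := by
  rw [← ContinuousLinearMap.adjoint_inner_right, adjoint_opTensor, adjoint_one_eq,
    ← ContinuousLinearMap.comp_apply, ← opTensor_comp]
  rfl

/-- The isometry `1 ⊗ t` for an isometry `t`. -/
noncomputable def opTensorIsometry (H : Type*) {L : Type*} [NormedAddCommGroup H]
    [InnerProductSpace ℂ H] [CompleteSpace H] [NormedAddCommGroup L] [InnerProductSpace ℂ L]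
    [CompleteSpace L] (t : L →ₗᵢ[ℂ] L) : HilbertTensor H L →ₗᵢ[ℂ] HilbertTensor H L :=
  (opTensor (1 : H →L[ℂ] H) t.toContinuousLinearMap).toLinearMap.isometryOfInner fun x y => by
    refine (inner_opTensor_one_opTensor_one _ _ x y).trans ?_
    rw [(ContinuousLinearMap.norm_map_iff_adjoint_comp_self t.toContinuousLinearMap).1 t.norm_map,
      opTensor_one_one]
    rfl

theorem coe_opTensorIsometry {L : Type*} [NormedAddCommGroup L] [InnerProductSpace ℂ L]
    [CompleteSpace L] (t : L →ₗᵢ[ℂ] L) : (opTensorIsometry H t).toContinuousLinearMap =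
      opTensor (1 : H →L[ℂ] H) t.toContinuousLinearMap := rfl

theorem orthogonalFamily_opTensorIsometry {L : Type*} [NormedAddCommGroup L]
    [InnerProductSpace ℂ L] [CompleteSpace L] {t : J → L →ₗᵢ[ℂ] L}
    (ht : ∀ i j, i ≠ j → ∀ x y, ⟪t i x, t j y⟫_ℂ = 0) :
    OrthogonalFamily ℂ (fun _ => HilbertTensor H L) fun j => opTensorIsometry H (t j) := by
  intro i j hij x y
  have h1 : (t i).toContinuousLinearMap.adjoint ∘L (t j).toContinuousLinearMap = 0 := by
    ext1 z
    refine ext_inner_left ℂ fun w => ?_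
    rw [ContinuousLinearMap.comp_apply, ContinuousLinearMap.adjoint_inner_right,
      zero_apply, inner_zero_right]
    exact ht i j hij w z
  refine (inner_opTensor_one_opTensor_one _ _ x y).trans ?_
  rw [h1, opTensor_zero_right, zero_apply, inner_zero_right]

theorem exists_column_isometry_normalTensor {M : Submodule ℂ (H →L[ℂ] K)} (hM : IsTRO M)
    (hnd : ∀ k : K, (∀ m ∈ M, m.adjoint k = 0) → k = 0) :
    ∃ m : (H →L[ℂ] K) × ℕ → H →L[ℂ] K,
      (∀ j (y : EllTwo J →L[ℂ] EllTwo J),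
        opTensor (m j) y ∈ normalTensorSubmodule J (M : Set (H →L[ℂ] K))) ∧
      ∀ k, HasSum (fun j => ‖(m j).adjoint k‖ ^ 2) (‖k‖ ^ 2) := by
  set X := normalTensorSubmodule J (M : Set (H →L[ℂ] K)) with hX
  -- N serves as a closed enlargement of M: it contains M, is a TRO, and inherits closure under
  -- bounded strong limits from X, while every m ⊗ y with m ∈ N still lies in X.
  let N : Submodule ℂ (H →L[ℂ] K) := ⨅ y : EllTwo J →L[ℂ] EllTwo J, X.comap (opTensorLeft y)
  have hN : ∀ {m}, m ∈ N ↔ ∀ y : EllTwo J →L[ℂ] EllTwo J, opTensor m y ∈ X := by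
    intro m
    simp [N, opTensorLeft_apply]
  have hXTRO : IsTRO X := hM.normalTensorSubmodule
  have hXclosed : IsWeakStarClosed
      (X : Set (HilbertTensor H (EllTwo J) →L[ℂ] HilbertTensor K (EllTwo J))) :=
    isWeakStarClosed_weakStarSubmodule _
  have hNTRO : IsTRO N := by
    intro a ha b hb c hc
    refine hN.2 fun y => ?_
    have h := hXTRO _ (hN.1 ha 1) _ (hN.1 hb 1) _ (hN.1 hc y)
    rw [adjoint_opTensor, ← opTensor_comp, ← opTensor_comp, adjoint_one_eq] at h
    exact h
  obtain ⟨m, hmN, hm⟩ := exists_column_isometry hNTRO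
    (fun T T₀ C hT hC hlim => hN.2 fun y =>
      hXclosed.mem_of_tendsto (l := atTop) (T := fun s => opTensor (T s) y) (C := C * ‖y‖)
        (fun s => hN.1 (hT s) y)
        (fun s => (norm_opTensor_le _ _).trans (by gcongr; exact hC s))
        fun x z => tendsto_const_nhds.inner (tendsto_opTensor hC hlim y x))
    (fun k hk => hnd k fun n hn => hk n (hN.2 fun y => opTensor_mem_normalTensorSubmodule hn y))
  exact ⟨m, fun j => hN.1 (hmN j), hm⟩

theorem exists_isometry_adjoint_mem_normalTensor {M : Submodule ℂ (H →L[ℂ] K)} (hM : IsTRO M)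
    (hnd : ∀ k : K, (∀ m ∈ M, m.adjoint k = 0) → k = 0)
    (e : J × J ≃ J) (φ : J ≃ (H →L[ℂ] K) × ℕ) :
    ∃ W : HilbertTensor K (EllTwo J) →ₗᵢ[ℂ] HilbertTensor H (EllTwo J),
      W.toContinuousLinearMap.adjoint ∈ normalTensorSubmodule J (M : Set (H →L[ℂ] K)) := by
  classical
  obtain ⟨m, hmX, hm⟩ := exists_column_isometry_normalTensor (J := J) hM hnd
  refine exists_isometry_of_column (isWeakStarClosed_weakStarSubmodule _)
    (x := fun j => opTensor (m (φ j)) (1 : EllTwo J →L[ℂ] EllTwo J))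
    (S := fun j => opTensorIsometry H (blockIsometry e j))
    (hasSum_norm_sq_adjoint_opTensor_one fun k => φ.hasSum_iff.2 (hm k))
    (orthogonalFamily_opTensorIsometry fun i j hij => inner_blockIsometry_of_ne e hij) fun j => ?_
  rw [coe_opTensorIsometry, adjoint_opTensor, adjoint_one_eq, ← opTensor_comp]
  exact hmX _ _

/-- The w*-continuous functional T ↦ ⟪k, T k⟫ vanishes on M A M*, hence on the closed span, which
contains 1. -/
theorem eq_zero_of_adjoint_apply_eq_zero {M : Set (H →L[ℂ] K)} {A : Set (H →L[ℂ] H)}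
    (h1 : 1 ∈ weakStarSpan {T | ∃ m ∈ M, ∃ a ∈ A, ∃ n ∈ M, T = m ∘L a ∘L n.adjoint})
    {k : K} (hk : ∀ m ∈ M, m.adjoint k = 0) : k = 0 := by
  let f : (K →L[ℂ] K) →ₗ[ℂ] ℂ := ((innerSL ℂ k) ∘L ContinuousLinearMap.apply ℂ K k).toLinearMap
  have hle : weakStarSubmodule {T | ∃ m ∈ M, ∃ a ∈ A, ∃ n ∈ M, T = m ∘L a ∘L n.adjoint} ≤
      LinearMap.ker f := by
    refine weakStarSubmodule_le ?_ ?_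
    · rintro _ ⟨m, hm, a, -, n, hn, rfl⟩
      simp [f, hk n hn]
    · exact @IsClosed.preimage _ _ (weakStarTopology K K) _ _
        (continuous_inner_apply_weakStarTopology k k) _ (isClosed_singleton (x := (0 : ℂ)))
  have : ⟪k, k⟫_ℂ = 0 := hle h1
  exact inner_self_eq_zero.1 this

end Main

theorem mainTheorem11 {H : Type u} {K : Type v}
    [NormedAddCommGroup H] [InnerProductSpace ℂ H] [CompleteSpace H]
    [NormedAddCommGroup K] [InnerProductSpace ℂ K] [CompleteSpace K]
    (A : Subalgebra ℂ (H →L[ℂ] H)) (B : Subalgebra ℂ (K →L[ℂ] K))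
    (hA : IsWeakStarClosed (A : Set (H →L[ℂ] H)))
    (hB : IsWeakStarClosed (B : Set (K →L[ℂ] K)))
    (hAB : TROEquivalent (A : Set (H →L[ℂ] H)) (B : Set (K →L[ℂ] K))) :
    ∃ (J : Type (max u v)) (_ : Infinite J)
      (U : HilbertTensor H (EllTwo J) ≃ₗᵢ[ℂ] HilbertTensor K (EllTwo J)),
      normalTensor (B : Set (K →L[ℂ] K)) (matrixOps J) =
        {T | ∃ S ∈ normalTensor (A : Set (H →L[ℂ] H)) (matrixOps J),
          T = (U : HilbertTensor H (EllTwo J) →L[ℂ] HilbertTensor K (EllTwo J)) ∘L S ∘L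
            (U : HilbertTensor H (EllTwo J) →L[ℂ] HilbertTensor K (EllTwo J)).adjoint} := by
  obtain ⟨M, hM, hAM, hBM⟩ := hAB
  -- J is the index type of the exhaustion for M; through the adjoint it is in bijection with the
  -- index type for M*, so one J serves both directions.
  let J : Type (max u v) := (H →L[ℂ] K) × ℕ
  have hJ : Infinite J := Prod.infinite_of_right
  obtain ⟨e⟩ : Nonempty (J × J ≃ J) :=
    Cardinal.eq.1 (by rw [Cardinal.mk_prod, Cardinal.lift_id,
      Cardinal.mul_eq_self (Cardinal.infinite_iff.1 hJ)])
  let adj := ContinuousLinearMap.adjoint (𝕜 := ℂ) (E := H) (F := K)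
  let M' : Submodule ℂ (K →L[ℂ] H) :=
    M.comap (ContinuousLinearMap.adjoint (𝕜 := ℂ) (E := K) (F := H)).toLinearEquiv.toLinearMap
  have hM'adj : ∀ {m : K →L[ℂ] H}, m ∈ M' ↔ m.adjoint ∈ M := Iff.rfl
  have hM'mem : ∀ {m : H →L[ℂ] K}, m ∈ M → m.adjoint ∈ M' := fun {m} hm => by
    rwa [hM'adj, ContinuousLinearMap.adjoint_adjoint]
  have hM' : IsTRO M' := by
    intro a ha b hb c hc
    rw [hM'adj]
    have := hM _ hc _ hb _ ha
    simpa [ContinuousLinearMap.adjoint_comp, ContinuousLinearMap.comp_assoc] using this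
  have hA' : ∀ m ∈ M, ∀ b ∈ B, ∀ n ∈ M, m.adjoint ∘L b ∘L n ∈ A := fun m hm b hb n hn => by
    rw [← SetLike.mem_coe, hAM]
    exact subset_weakStarSubmodule _ ⟨m, hm, b, hb, n, hn, rfl⟩
  have hB' : ∀ m ∈ M, ∀ a ∈ A, ∀ n ∈ M, m ∘L a ∘L n.adjoint ∈ B := fun m hm a ha n hn => by
    rw [← SetLike.mem_coe, hBM]
    exact subset_weakStarSubmodule _ ⟨m, hm, a, ha, n, hn, rfl⟩
  have hndK : ∀ k : K, (∀ m ∈ M, m.adjoint k = 0) → k = 0 := fun k hk => by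
    have h1 : (1 : K →L[ℂ] K) ∈ (B : Set (K →L[ℂ] K)) := B.one_mem
    rw [hBM] at h1
    exact eq_zero_of_adjoint_apply_eq_zero (M := (M : Set (H →L[ℂ] K)))
      (A := (A : Set (H →L[ℂ] H))) h1 hk
  have hndH : ∀ h : H, (∀ m ∈ M', m.adjoint h = 0) → h = 0 := fun h hh => by
    refine eq_zero_of_adjoint_apply_eq_zero (M := (M' : Set (K →L[ℂ] H)))
      (A := (B : Set (K →L[ℂ] K))) ?_ hh
    have h1 : (1 : H →L[ℂ] H) ∈ (A : Set (H →L[ℂ] H)) := A.one_mem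
    rw [hAM] at h1
    refine (weakStarSubmodule_le (N := weakStarSubmodule _) ?_
      (isWeakStarClosed_weakStarSubmodule _)) h1
    rintro _ ⟨m, hm, b, hb, n, hn, rfl⟩
    exact subset_weakStarSubmodule _ ⟨_, hM'mem hm, b, hb, _, hM'mem hn, by simp⟩
  obtain ⟨W, hW⟩ := exists_isometry_adjoint_mem_normalTensor hM hndK e (Equiv.refl _)
  obtain ⟨V, hV⟩ := exists_isometry_adjoint_mem_normalTensor hM' hndH e
    (adj.toEquiv.prodCongr (Equiv.refl ℕ))
  have hV' : V.toContinuousLinearMap ∈ normalTensorSubmodule J (M : Set (H →L[ℂ] K)) := by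
    have := adjoint_mem_normalTensorSubmodule (Y := (M : Set (H →L[ℂ] K))) (fun _ hx => hx) hV
    rwa [ContinuousLinearMap.adjoint_adjoint] at this
  obtain ⟨U, hU⟩ := exists_unitary_of_isometries (hM.normalTensorSubmodule (J := J))
    (isWeakStarClosed_weakStarSubmodule _) V hV' W hW
  refine ⟨J, hJ, U, ?_⟩
  set Uc : HilbertTensor H (EllTwo J) →L[ℂ] HilbertTensor K (EllTwo J) :=
    (U : HilbertTensor H (EllTwo J) →L[ℂ] HilbertTensor K (EllTwo J)) with hUc
  have hUadj : Uc.adjoint ∈ normalTensorSubmodule J (M' : Set (K →L[ℂ] H)) :=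
    adjoint_mem_normalTensorSubmodule (fun x hx => hM'mem hx) hU
  have hUU : ∀ y, Uc (Uc.adjoint y) = y := fun y => by
    obtain ⟨x, rfl⟩ := U.surjective y
    refine congrArg Uc (ext_inner_right ℂ fun z => ?_)
    rw [ContinuousLinearMap.adjoint_inner_left]
    exact U.inner_map_map x z
  ext T
  constructor
  · intro hT
    -- Membership in A ⊗̄ M_J uses U ∈ M ⊗̄ M_J, U* ∈ M* ⊗̄ M_J and M* B M ⊆ A.
    refine ⟨Uc.adjoint ∘L T ∘L Uc, ?_, ?_⟩
    · refine mem_normalTensorSubmodule.1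
        (comp_comp_mem_normalTensorSubmodule (fun x hx y hy z hz => ?_) hUadj
          (mem_normalTensorSubmodule.2 hT) hU)
      simpa using hA' _ hx y hy z hz
    · ext1 y
      simp [hUU]
  · rintro ⟨S, hS, rfl⟩
    refine mem_normalTensorSubmodule.1
      (comp_comp_mem_normalTensorSubmodule (fun x hx y hy z hz => ?_) hU
        (mem_normalTensorSubmodule.2 hS) hUadj)
    simpa using hB' x hx y hy _ hz
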